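/- Let $\mathscr B=\{A,B,C,D\}$ with the discrete topology, let $\mathscr B^{\mathbb Z}$ carry the product topology, and let $(\tau^m\xi)(n)=\xi(n-m)$ for $\xi\in\mathscr B^{\mathbb Z}$, $m,n\in\mathbb Z$. Let $S$ be the Golay–Rudin–Shapiro substitution $A\mapsto AB$, $B\mapsto AC$, $C\mapsto DB$, $D\mapsto DC$, extended to finite words by concatenation and to two-sided infinite words by letting $S(\xi(n))$ occupy the positions $2n,2n+1$ of $S(\xi)$. The Golay–Rudin–Shapiro subshift $\Xi\subseteq\mathscr B^{\mathbb Z}$ is the set of all $\xi$ each of whose finite subwords is a subword of $S^n(a)$ for some $n\in\mathbb N$ and $a\in\mathscr B$. For $x\in\mathscr B$ and $k\in\mathbb N$ let $\eta^x_k:=S^k(x^\infty)$, where $x^\infty$ is the constant two-sided infinite word with letter $x$; these configurations are periodic. Let $K\subseteq\mathbb Z\setminus\{0\}$ be finite, let $v:\mathscr B^{\mathbb Z}\to\mathbb C$ and $t_k:\mathscr B^{\mathbb Z}\to\mathbb C$ ($k\in K$) be continuous, and for $\xi\in\mathscr B^{\mathbb Z}$ let $H_\xi$ be the bounded operator on $\ell^2(\mathbb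 Z)$ given by $$(H_\xi\psi)(n)=\sum_{k\in K}t_k(\tau^{-n}\xi)\,\psi(n-k)+v(\tau^{-n}\xi)\,\psi(n).$$ Assume that $v$ is real valued, that $K=-K$, and that $t_{-k}(\xi)=\overline{t_k(\tau^{-k}\xi)}$ for all $k\in K$ and $\xi\in\mathscr B^{\mathbb Z}$ (so that every $H_\xi$ is self-adjoint). Then, for every $\xi\in\Xi$ and every $x\in\{A,B,C,D\}$, $$\sigma(H_\xi)=\lim_{k\to\infty}\sigma(H_{\eta^x_k})$$ with respect to the Hausdorff metric on the nonempty compact subsets of $\mathbb R$. -/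

import Mathlib

open Filter Topology
open scoped ComplexConjugate

noncomputable section

/-! ### Configurations and the shift -/

/-- The configuration space of two-sided infinite words over `A`, with the product topology. -/
abbrev Config (A : Type*) := ℤ → A

/-- The translation `(τ^m ξ)(n) = ξ(n - m)`. -/
def Config.shift {A : Type*} (m : ℤ) (ξ : Config A) : Config A := fun n => ξ (n - m)

/-- The finite subword `ξ(m) ξ(m+1) … ξ(m+l-1)` of a configuration. -/
def Config.subword {A : Type*} (ξ : Config A) (m : ℤ) (l : ℕ) : List A :=
  (List.range l).map fun i => ξ (m + i)

/-! ### Finite range Hamiltonians -/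

/-- The data of a finite range Hamiltonian over the alphabet `A`: a finite set `K` of nonzero
integers, continuous hopping functions `t k` (only those with `k ∈ K` are used) and a continuous
function `v`. -/
structure FiniteRangeHamiltonian (A : Type*) [TopologicalSpace A] where
  K : Finset ℤ
  zero_notMem : (0 : ℤ) ∉ K
  t : ℤ → C(Config A, ℂ)
  v : C(Config A, ℂ)

/-- The conditions that make all the operators `H_ξ` self-adjoint. -/
structure FiniteRangeHamiltonian.IsHermitian {A : Type*} [TopologicalSpace A]
    (H : FiniteRangeHamiltonian A) : Prop where
  v_real : ∀ ξ, (H.v ξ).im = 0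
  neg_mem : ∀ k ∈ H.K, -k ∈ H.K
  t_neg : ∀ k ∈ H.K, ∀ ξ, H.t (-k) ξ = conj (H.t k (ξ.shift (-k)))

/-- The Hilbert space `ℓ²(ℤ)`. -/
abbrev EllTwo := lp (fun _ : ℤ => ℂ) 2

/-- The translation `(U_m ψ)(n) = ψ(n - m)` on `ℓ²(ℤ)`. -/
def translationOp (m : ℤ) : EllTwo →L[ℂ] EllTwo :=
  LinearMap.mkContinuous
    { toFun := fun ψ => ⟨fun n => ψ (n - m), by
        have h := (lp.memℓp ψ).summable (by norm_num)
        exact memℓp_gen (h.comp_injective (Equiv.subRight m).injective)⟩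
      map_add' := fun _ _ => rfl
      map_smul' := fun _ _ => rfl }
    1
    (fun ψ => by
      rw [one_mul, lp.norm_eq_tsum_rpow (by norm_num), lp.norm_eq_tsum_rpow (by norm_num) ψ]
      exact le_of_eq (congrArg (fun s : ℝ => s ^ (1 / (2 : ENNReal).toReal))
        ((Equiv.subRight m).tsum_eq fun n => ‖ψ n‖ ^ (2 : ENNReal).toReal)))

instance : Nontrivial EllTwo :=
  ⟨lp.single 2 0 1, 0, fun h => by simpa using congrArg (fun ψ : EllTwo => ψ 0) h⟩

theorem translationOp_apply (m : ℤ) (ψ : EllTwo) (n : ℤ) :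
    translationOp m ψ n = ψ (n - m) := rfl

section

variable {A : Type*} [Finite A] [TopologicalSpace A]

/-- Multiplication by the function `n ↦ g(τ^{-n} ξ)` on `ℓ²(ℤ)`. -/
def multiplicationOp (g : C(Config A, ℂ)) (ξ : Config A) : EllTwo →L[ℂ] EllTwo :=
  lp.mapCLM 2 (fun n : ℤ => g (ξ.shift (-n)) • ContinuousLinearMap.id ℂ ℂ) (norm_nonneg g)
    (fun n => by
      rw [norm_smul, ContinuousLinearMap.norm_id, mul_one]
      exact g.norm_coe_le_norm _)

theorem multiplicationOp_apply (g : C(Config A, ℂ)) (ξ : Config A) (ψ : EllTwo) (n : ℤ) :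
    multiplicationOp g ξ ψ n = g (ξ.shift (-n)) * ψ n := rfl

namespace FiniteRangeHamiltonian

variable (H : FiniteRangeHamiltonian A)

/-- The bounded operator `H_ξ = ∑_{k ∈ K} t̂_{ξ,k} U_k + v̂_ξ` on `ℓ²(ℤ)`. -/
def op (ξ : Config A) : EllTwo →L[ℂ] EllTwo :=
  ∑ k ∈ H.K, multiplicationOp (H.t k) ξ ∘L translationOp k + multiplicationOp H.v ξ

theorem op_apply (ξ : Config A) (ψ : EllTwo) (n : ℤ) :
    H.op ξ ψ n =
      ∑ k ∈ H.K, H.t k (ξ.shift (-n)) * ψ (n - k) + H.v (ξ.shift (-n)) * ψ n := by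
  have h : H.op ξ ψ = ∑ k ∈ H.K, multiplicationOp (H.t k) ξ (translationOp k ψ) +
      multiplicationOp H.v ξ ψ := by
    simp [op]
  rw [h, lp.coeFn_add, lp.coeFn_sum, Pi.add_apply, Finset.sum_apply]
  rfl

theorem inner_hopping (hH : H.IsHermitian) (ξ : Config A) (k : ℤ) (hk : k ∈ H.K)
    (φ ψ : EllTwo) :
    inner ℂ (multiplicationOp (H.t k) ξ (translationOp k φ)) ψ =
      inner ℂ φ (multiplicationOp (H.t (-k)) ξ (translationOp (-k) ψ)) := by
  rw [lp.inner_eq_tsum, lp.inner_eq_tsum]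
  refine ((Equiv.addRight k).tsum_eq _).symm.trans (tsum_congr fun n => ?_)
  have hs : Config.shift (-k) (Config.shift (-n) ξ) = Config.shift (-(n + k)) ξ := by
    funext j
    exact congrArg ξ (by ring)
  simp only [Equiv.coe_addRight, multiplicationOp_apply, translationOp_apply, RCLike.inner_apply,
    map_mul, hH.t_neg k hk, hs, add_sub_cancel_right, sub_neg_eq_add]
  ring

theorem inner_potential (hH : H.IsHermitian) (ξ : Config A) (φ ψ : EllTwo) :
    inner ℂ (multiplicationOp H.v ξ φ) ψ = inner ℂ φ (multiplicationOp H.v ξ ψ) := by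
  rw [lp.inner_eq_tsum, lp.inner_eq_tsum]
  refine tsum_congr fun n => ?_
  have hv : conj (H.v (ξ.shift (-n))) = H.v (ξ.shift (-n)) :=
    Complex.conj_eq_iff_im.2 (hH.v_real _)
  simp only [multiplicationOp_apply, RCLike.inner_apply, map_mul, hv]
  ring

theorem isSelfAdjoint_op (hH : H.IsHermitian) (ξ : Config A) : IsSelfAdjoint (H.op ξ) := by
  rw [ContinuousLinearMap.isSelfAdjoint_iff_isSymmetric]
  intro φ ψ
  simp only [op, ContinuousLinearMap.coe_coe, add_apply, sum_apply,
    ContinuousLinearMap.comp_apply, inner_add_left, inner_add_right,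
    sum_inner, inner_sum, H.inner_potential hH]
  congr 1
  rw [Finset.sum_congr rfl fun k hk => H.inner_hopping hH ξ k hk φ ψ]
  exact Finset.sum_nbij' (fun k => -k) (fun k => -k) hH.neg_mem hH.neg_mem
    (fun k _ => neg_neg k) (fun k _ => neg_neg k) (fun k _ => rfl)

/-- The spectrum of `H_ξ`, as a nonempty compact subset of the real line.
The space `NonemptyCompacts ℝ` carries the Hausdorff metric. -/
def spec (hH : H.IsHermitian) (ξ : Config A) : TopologicalSpace.NonemptyCompacts ℝ where
  carrier := {E : ℝ | (E : ℂ) ∈ spectrum ℂ (H.op ξ)}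
  isCompact' := spectrum.isCompact (𝕜 := ℝ) (H.op ξ)
  nonempty' := by
    obtain ⟨z, hz⟩ := spectrum.nonempty (H.op ξ)
    have h := (H.isSelfAdjoint_op hH ξ).mem_spectrum_eq_re hz
    exact ⟨z.re, show ((z.re : ℝ) : ℂ) ∈ spectrum ℂ (H.op ξ) from h ▸ hz⟩

/-- The spectrum of `H_ξ` contains no other points of the complex plane. -/
theorem image_spec (hH : H.IsHermitian) (ξ : Config A) :
    (fun E : ℝ => (E : ℂ)) '' (H.spec hH ξ : Set ℝ) = spectrum ℂ (H.op ξ) := by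
  ext z
  constructor
  · rintro ⟨E, hE, rfl⟩
    exact hE
  · intro hz
    have h := (H.isSelfAdjoint_op hH ξ).mem_spectrum_eq_re hz
    exact ⟨z.re, show ((z.re : ℝ) : ℂ) ∈ spectrum ℂ (H.op ξ) from h ▸ hz, h.symm⟩

end FiniteRangeHamiltonian

end

/-! ### The Golay–Rudin–Shapiro substitution -/

inductive GRSLetter
  | A | B | C | D
  deriving DecidableEq

instance : Fintype GRSLetter :=
  ⟨{.A, .B, .C, .D}, fun a => by cases a <;> decide⟩

instance : TopologicalSpace GRSLetter := ⊥

instance : DiscreteTopology GRSLetter := ⟨rfl⟩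

namespace GRSLetter

/-- The substitution `A ↦ AB, B ↦ AC, C ↦ DB, D ↦ DC` on letters. -/
def subst : GRSLetter → GRSLetter × GRSLetter
  | A => (A, B)
  | B => (A, C)
  | C => (D, B)
  | D => (D, C)

/-- The substitution on finite words. -/
def substWord (w : List GRSLetter) : List GRSLetter :=
  w.flatMap fun a => [(subst a).1, (subst a).2]

/-- The substitution on two-sided infinite words: the image of the letter at position `n` stands
at the positions `2n` and `2n + 1`. -/
def substConfig (ξ : Config GRSLetter) : Config GRSLetter := fun n =>
  if Even n then (subst (ξ (n / 2))).1 else (subst (ξ (n / 2))).2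

/-- The dictionary of the substitution: all subwords of the words `S^n(a)`. -/
def dictionary : Set (List GRSLetter) :=
  {w | ∃ (n : ℕ) (a : GRSLetter), w <:+: substWord^[n] [a]}

/-- The Golay–Rudin–Shapiro subshift: the configurations all of whose finite subwords belong to
the dictionary. -/
def subshift : Set (Config GRSLetter) :=
  {ξ | ∀ (m : ℤ) (l : ℕ), ξ.subword m l ∈ dictionary}

/-- The periodic configuration `η^x_k = S^k(x^∞)`. -/
def eta (x : GRSLetter) (k : ℕ) : Config GRSLetter := substConfig^[k] fun _ => x

end GRSLetter

end

/-!
For large `k` the periodic configuration `η = S^k(x^∞)` has the same subwords of any given length as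
`ξ`, and two configurations with the same long subwords have operators with nearby spectra.

*Subwords.* The letters occur in all the words `S^3(b)`, hence each word of the dictionary occurs in
all the words `S^n(b)` with `n` large (`GRSLetter.exists_forall_infix_of_mem_dictionary`). A long
subword of `ξ` contains a complete block `S^n(b)`, so `ξ` contains the whole dictionary, and so does
`S^k(x^∞)` up to a given length. In the other direction, `xx` is not legal, but all two-letter words
of `S(x^∞)` are, and a short subword of `S^k(x^∞)` lies in `S^(k-1)(ab)` for such a word `ab`. This
gives `GRSLetter.eventually_range_subword_eta_eq`.

*Spectra.* For a self-adjoint `T` and a real `x`, the distance of `x` from the spectrum is the best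
constant `c` in `c ‖φ‖ ≤ ‖(T - x) φ‖`. Such a lower bound can be tested on vectors supported in
windows of a fixed length `N`, at the price of half the constant
(`FiniteRangeHamiltonian.exists_window_forall_mul_norm_le`): summed over all translates `P` of the
window, `‖P ψ‖²` gives `N ‖ψ‖²`, whereas the squared norm of the commutator of `P` with a hopping
term over distance `|k|` gives at most a constant times `2 |k| ‖ψ‖²`, since `[0, N)` and its
translate by `k` differ in at most `2 |k|` points. On vectors supported in a window `H_η` is close
in norm to a translate of `H_ξ`, because `t_k` and `v` depend on finitely many letters up to a small
error and every long subword of `η` occurs in `ξ`. So a point far from the spectrum of `H_ξ` is not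
in the spectrum of `H_η` (`FiniteRangeHamiltonian.exists_length_forall_mem_spec`), uniformly in `ξ`
and `η`, and exchanging the two configurations bounds the Hausdorff distance.
-/

/-! ### Subwords of configurations -/

namespace Config

variable {A : Type*}

theorem subword_eq_map (ξ : Config A) (m : ℤ) (l : ℕ) :
    ξ.subword m l = (List.range l).map fun i : ℕ => ξ (m + i) := by
  simp [subword, List.map_eq_flatMap, List.flatMap_assoc]

theorem length_subword (ξ : Config A) (m : ℤ) (l : ℕ) : (ξ.subword m l).length = l := by
  simp [subword]

theorem getElem_subword (ξ : Config A) (m : ℤ) (l i : ℕ) (h : i < (ξ.subword m l).length) :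
    (ξ.subword m l)[i] = ξ (m + i) := by
  simp [subword_eq_map]

theorem subword_add (ξ : Config A) (m : ℤ) (l l' : ℕ) :
    ξ.subword m (l + l') = ξ.subword m l ++ ξ.subword (m + l) l' := by
  simp [subword_eq_map, List.range_add, add_assoc]

/-- The subword on a subinterval is a factor. -/
theorem subword_infix_subword (ξ : Config A) {m m' : ℤ} {l l' : ℕ} (h : m ≤ m')
    (h' : m' + l' ≤ m + l) : ξ.subword m' l' <:+: ξ.subword m l := by
  obtain ⟨a, rfl⟩ := Int.le.dest h
  obtain ⟨b, rfl⟩ : ∃ b : ℕ, l = a + l' + b := Nat.exists_eq_add_of_le (by omega)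
  rw [subword_add, subword_add]
  exact ⟨_, _, rfl⟩

/-- A factor of a subword is a subword. -/
theorem exists_subword_eq_of_infix (ξ : Config A) {m : ℤ} {l : ℕ} {w : List A}
    (h : w <:+: ξ.subword m l) :
    ∃ m' : ℤ, m ≤ m' ∧ m' + w.length ≤ m + l ∧ ξ.subword m' w.length = w := by
  obtain ⟨p, s, h⟩ := h
  have hl : p.length + w.length + s.length = l := by
    simpa [length_subword, add_assoc] using congrArg List.length h
  refine ⟨m + p.length, by omega, by omega, ?_⟩
  rw [← hl, subword_add, subword_add] at h
  have h₁ := (List.append_inj h (by simp [length_subword])).1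
  exact (List.append_inj h₁ (by simp [length_subword])).2.symm

theorem apply_eq_of_subword_eq {ξ η : Config A} {m m' : ℤ} {l : ℕ}
    (h : ξ.subword m l = η.subword m' l) {i : ℕ} (hi : i < l) : ξ (m + i) = η (m' + i) := by
  rw [← getElem_subword ξ m l i (by rwa [length_subword]),
    ← getElem_subword η m' l i (by rwa [length_subword])]
  simp only [h]

end Config

/-! ### The dictionary of the Golay–Rudin–Shapiro substitution -/

namespace GRSLetter

theorem substWord_append (u v : List GRSLetter) :
    substWord (u ++ v) = substWord u ++ substWord v :=
  List.flatMap_append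

theorem iterate_substWord_append (n : ℕ) (u v : List GRSLetter) :
    substWord^[n] (u ++ v) = substWord^[n] u ++ substWord^[n] v := by
  induction n generalizing u v with
  | zero => rfl
  | succ n ih => rw [Function.iterate_succ_apply, substWord_append, ih]; rfl

theorem iterate_substWord_infix {u v : List GRSLetter} (n : ℕ) (h : u <:+: v) :
    substWord^[n] u <:+: substWord^[n] v := by
  obtain ⟨p, s, rfl⟩ := h
  rw [iterate_substWord_append, iterate_substWord_append]
  exact ⟨_, _, rfl⟩

theorem length_substWord (w : List GRSLetter) : (substWord w).length = 2 * w.length := by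
  simp [substWord, mul_comm]

theorem length_iterate_substWord (n : ℕ) (w : List GRSLetter) :
    (substWord^[n] w).length = 2 ^ n * w.length := by
  induction n with
  | zero => simp
  | succ n ih => rw [Function.iterate_succ_apply', length_substWord, ih]; ring

theorem subword_substConfig (ξ : Config GRSLetter) (m : ℤ) (l : ℕ) :
    (substConfig ξ).subword (2 * m) (2 * l) = substWord (ξ.subword m l) := by
  induction l with
  | zero => rfl
  | succ l ih =>
    have h₁ : (2 * m + 2 * l) / 2 = m + l := by omega
    have h₂ : (2 * m + 2 * l + 1) / 2 = m + l := by omega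
    have h₃ : ¬ Even (2 * m + 2 * (l : ℤ) + 1) := by
      rw [Int.not_even_iff]; omega
    have h₄ : Even (2 * m + 2 * (l : ℤ)) := by
      rw [Int.even_iff]; omega
    rw [mul_add_one, Config.subword_add, ih, Config.subword_add, substWord_append]
    simp [Config.subword, substWord, substConfig, List.range_succ, h₁, h₂, h₃, h₄]

theorem subword_iterate_substConfig (n : ℕ) (ξ : Config GRSLetter) (m : ℤ) (l : ℕ) :
    (substConfig^[n] ξ).subword (2 ^ n * m) (2 ^ n * l) = substWord^[n] (ξ.subword m l) := by
  induction n with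
  | zero => simp
  | succ n ih =>
    rw [Function.iterate_succ_apply', Function.iterate_succ_apply', pow_succ', pow_succ',
      mul_assoc, mul_assoc, subword_substConfig, ih]

theorem mem_dictionary_of_infix {u v : List GRSLetter} (h : u <:+: v) (hv : v ∈ dictionary) :
    u ∈ dictionary := by
  obtain ⟨n, a, hv⟩ := hv
  exact ⟨n, a, h.trans hv⟩

theorem iterate_substWord_mem_dictionary {w : List GRSLetter} (n : ℕ) (hw : w ∈ dictionary) :
    substWord^[n] w ∈ dictionary := by
  obtain ⟨m, a, hw⟩ := hw
  refine ⟨n + m, a, ?_⟩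
  rw [Function.iterate_add_apply]
  exact iterate_substWord_infix n hw

theorem letter_infix_substWord_three (a b : GRSLetter) : [a] <:+: substWord^[3] [b] := by
  cases a <;> cases b <;> decide

/-- The substitution is primitive: every word of the dictionary is a factor of all the words
`S^n(b)` with `n` sufficiently large. -/
theorem exists_forall_infix_of_mem_dictionary {w : List GRSLetter} (hw : w ∈ dictionary) :
    ∃ n₀ : ℕ, ∀ n ≥ n₀, ∀ b : GRSLetter, w <:+: substWord^[n] [b] := by
  obtain ⟨m, a, hw⟩ := hw
  refine ⟨m + 3, fun n hn b => ?_⟩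
  obtain ⟨j, rfl⟩ := Nat.exists_eq_add_of_le hn
  rw [Function.iterate_add_apply, Function.iterate_add_apply]
  obtain ⟨c, t, hc⟩ : ∃ c t, substWord^[j] [b] = c :: t := by
    refine List.exists_cons_of_ne_nil (List.ne_nil_of_length_pos ?_)
    rw [length_iterate_substWord]
    simp
  rw [hc]
  exact hw.trans (iterate_substWord_infix m ((letter_infix_substWord_three a c).trans
    (iterate_substWord_infix 3 (List.infix_append' [] [c] t))))

/-- Every factor of `S^n(v)` of length `2^n * 2` contains a complete block `S^n(a)`. -/
theorem exists_block_infix {n : ℕ} {u v : List GRSLetter} (h : u <:+: substWord^[n] v)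
    (hu : u.length = 2 ^ n * 2) : ∃ a : GRSLetter, substWord^[n] [a] <:+: u := by
  let ζ : Config GRSLetter := fun i => v.getD i.toNat A
  have hζ : ζ.subword 0 v.length = v := by
    refine List.ext_getElem (Config.length_subword _ _ _) fun i h₁ h₂ => ?_
    simp [Config.getElem_subword, ζ, h₂]
  rw [← hζ, ← subword_iterate_substConfig] at h
  obtain ⟨p, hp, -, hpu⟩ := Config.exists_subword_eq_of_infix _ h
  -- The first multiple of `2 ^ n` that is `≥ p` starts a block inside the window of `u`.
  have hpos : (0 : ℤ) < 2 ^ n := by positivity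
  have h₁ := Int.emod_nonneg (-p) hpos.ne'
  have h₂ := Int.emod_lt_of_pos (-p) hpos
  have h₃ := Int.mul_ediv_add_emod (-p) (2 ^ n)
  refine ⟨ζ (-(-p / 2 ^ n)), ?_⟩
  have hb : substWord^[n] [ζ (-(-p / 2 ^ n))] =
      (substConfig^[n] ζ).subword (2 ^ n * (-(-p / 2 ^ n))) (2 ^ n * 1) := by
    rw [subword_iterate_substConfig]
    simp [Config.subword, List.range_succ]
  rw [hb, ← hpu, hu]
  apply Config.subword_infix_subword
  · rw [mul_neg]; linarith
  · rw [mul_neg]; push_cast; linarith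

/-- The subshift is minimal: every configuration in it contains all words of the dictionary. -/
theorem exists_subword_eq_of_mem_subshift {ξ : Config GRSLetter} (hξ : ξ ∈ subshift)
    {w : List GRSLetter} (hw : w ∈ dictionary) : ∃ m : ℤ, ξ.subword m w.length = w := by
  obtain ⟨n, hn⟩ := exists_forall_infix_of_mem_dictionary hw
  obtain ⟨k, b, hk⟩ := hξ 0 (2 ^ n * 2)
  have hnk : n ≤ k := by
    have := hk.length_le
    rw [Config.length_subword, length_iterate_substWord, List.length_singleton, mul_one,
      ← pow_succ] at this
    have := (Nat.pow_le_pow_iff_right (by norm_num)).1 this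
    omega
  obtain ⟨j, rfl⟩ := Nat.exists_eq_add_of_le hnk
  rw [Function.iterate_add_apply] at hk
  obtain ⟨a, ha⟩ := exists_block_infix hk (Config.length_subword _ _ _)
  obtain ⟨m, -, -, hm⟩ := ξ.exists_subword_eq_of_infix ((hn n le_rfl a).trans ha)
  exact ⟨m, hm⟩

theorem eventually_exists_subword_eta_eq (x : GRSLetter) {w : List GRSLetter}
    (hw : w ∈ dictionary) : ∀ᶠ k in atTop, ∃ m : ℤ, (eta x k).subword m w.length = w := by
  obtain ⟨n, hn⟩ := exists_forall_infix_of_mem_dictionary hw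
  filter_upwards [eventually_ge_atTop n] with k hk
  have hb : substWord^[k] [x] = (eta x k).subword (2 ^ k * 0) (2 ^ k * 1) := by
    rw [eta, subword_iterate_substConfig]
    simp [Config.subword, List.range_succ]
  have h := hn k hk x
  rw [hb] at h
  obtain ⟨m, -, -, hm⟩ := Config.exists_subword_eq_of_infix _ h
  exact ⟨m, hm⟩

/-- The two-letter words of `S(x^∞)` are legal, although `xx` is not. -/
theorem subword_eta_one_mem_dictionary (x : GRSLetter) (m : ℤ) :
    (eta x 1).subword m 2 ∈ dictionary := by
  have h : (eta x 1).subword m 2 = [(subst x).1, (subst x).2] ∨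
      (eta x 1).subword m 2 = [(subst x).2, (subst x).1] := by
    by_cases hm : Even m
    · left
      simp [eta, substConfig, Config.subword, List.range_succ, hm]
    · right
      simp [eta, substConfig, Config.subword, List.range_succ, hm]
  refine ⟨4, A, ?_⟩
  rcases h with h | h <;> rw [h] <;> cases x <;> decide

/-- A short subword of `S^k(x^∞)` meets at most two blocks `S^(k-1)(a)`, `S^(k-1)(b)`, where `ab`
is a subword of `S(x^∞)`, so that it is legal. -/
theorem eventually_subword_eta_mem_dictionary (x : GRSLetter) (l : ℕ) :
    ∀ᶠ k in atTop, ∀ m : ℤ, (eta x k).subword m l ∈ dictionary := by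
  filter_upwards [eventually_ge_atTop (l + 1)] with k hk m
  obtain ⟨n, rfl⟩ : ∃ n, k = n + 1 := ⟨k - 1, by omega⟩
  have hl : (l : ℤ) ≤ 2 ^ n := by
    exact_mod_cast (show l ≤ n by omega).trans n.lt_two_pow_self.le
  have hpos : (0 : ℤ) < 2 ^ n := by positivity
  have h₁ := Int.emod_nonneg m hpos.ne'
  have h₂ := Int.emod_lt_of_pos m hpos
  have h₃ := Int.mul_ediv_add_emod m (2 ^ n)
  have h := iterate_substWord_mem_dictionary n (subword_eta_one_mem_dictionary x (m / 2 ^ n))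
  rw [← subword_iterate_substConfig, eta, ← Function.iterate_add_apply] at h
  refine mem_dictionary_of_infix (Config.subword_infix_subword _ ?_ ?_) h
  · linarith
  · push_cast; linarith

/-- For large `k` the configuration `S^k(x^∞)` has the same subwords of a given length as any
element of the subshift. -/
theorem eventually_range_subword_eta_eq {ξ : Config GRSLetter} (hξ : ξ ∈ subshift)
    (x : GRSLetter) (l : ℕ) :
    ∀ᶠ k in atTop, Set.range (fun m => (eta x k).subword m l) =
      Set.range fun m => ξ.subword m l := by
  have hfin : {w : List GRSLetter | w.length = l}.Finite := List.finite_length_eq _ l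
  have h : ∀ᶠ k in atTop, ∀ w ∈ {w : List GRSLetter | w.length = l}, w ∈ dictionary →
      ∃ m : ℤ, (eta x k).subword m w.length = w := by
    rw [hfin.eventually_all]
    intro w _
    by_cases hw : w ∈ dictionary
    · simpa only [hw, forall_const] using eventually_exists_subword_eta_eq x hw
    · exact Eventually.of_forall fun k hk => absurd hk hw
  filter_upwards [h, eventually_subword_eta_mem_dictionary x l] with k h₁ h₂
  refine Set.Subset.antisymm ?_ ?_
  · rintro _ ⟨m, rfl⟩
    simpa only [Config.length_subword, Set.mem_range] using
      exists_subword_eq_of_mem_subshift hξ (h₂ m)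
  · rintro _ ⟨m, rfl⟩
    simpa only [Config.length_subword, Set.mem_range] using
      h₁ _ (Config.length_subword ξ m l) (hξ m l)

end GRSLetter

/-! ### Bounded below self-adjoint operators -/

section Hilbert

variable {E : Type*} [NormedAddCommGroup E] [InnerProductSpace ℂ E] [CompleteSpace E]

/-- A self-adjoint operator that is bounded below is invertible. -/
theorem IsSelfAdjoint.isUnit_of_forall_mul_norm_le {T : E →L[ℂ] E} (hT : IsSelfAdjoint T) {c : ℝ}
    (hc : 0 < c) (h : ∀ φ, c * ‖φ‖ ≤ ‖T φ‖) : IsUnit T := by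
  have hanti : AntilipschitzWith (Real.toNNReal c⁻¹) T := by
    refine AddMonoidHomClass.antilipschitz_of_bound T fun φ => ?_
    rw [Real.coe_toNNReal _ (inv_nonneg.2 hc.le), inv_mul_eq_div, le_div_iff₀ hc, mul_comm]
    exact h φ
  rw [ContinuousLinearMap.isUnit_iff_bijective,
    ContinuousLinearMap.bijective_iff_dense_range_and_antilipschitz]
  refine ⟨?_, _, hanti⟩
  rw [Submodule.topologicalClosure_eq_top_iff, ContinuousLinearMap.orthogonal_range,
    hT.adjoint_eq]
  exact LinearMap.ker_eq_bot.2 hanti.injective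

/-- For a self-adjoint operator `T` and a real point `x` at distance at least `ε` from the
spectrum, `T - x` is bounded below by `ε`. -/
theorem IsSelfAdjoint.mul_norm_le_of_forall_le_abs_sub [Nontrivial E] {T : E →L[ℂ] E}
    (hT : IsSelfAdjoint T) {x ε : ℝ} (hε : 0 < ε)
    (h : ∀ y : ℝ, (y : ℂ) ∈ spectrum ℂ T → ε ≤ |y - x|) (φ : E) :
    ε * ‖φ‖ ≤ ‖T φ - (x : ℂ) • φ‖ := by
  have hx : IsUnit (T - algebraMap ℂ (E →L[ℂ] E) x) := by
    rw [← neg_sub, IsUnit.neg_iff, ← spectrum.notMem_iff]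
    intro hx
    simpa [hε.not_ge] using h x hx
  have hsa : IsSelfAdjoint (T - algebraMap ℂ (E →L[ℂ] E) x) :=
    hT.sub (IsSelfAdjoint.algebraMap _ (Complex.conj_ofReal x))
  obtain ⟨u, hu⟩ := hx
  have hinv : IsSelfAdjoint (↑u⁻¹ : E →L[ℂ] E) := by
    have : IsSelfAdjoint u := Units.ext (by rw [Units.coe_star, hu]; exact hsa)
    exact congrArg Units.val this.inv.star_eq
  have hnorm : ‖(↑u⁻¹ : E →L[ℂ] E)‖ ≤ ε⁻¹ := by
    have hr := hinv.spectralRadius_eq_nnnorm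
    have hle : spectralRadius ℂ (↑u⁻¹ : E →L[ℂ] E) ≤ (Real.toNNReal ε⁻¹ : NNReal) := by
      refine iSup₂_le fun z hz => ?_
      have hz0 : z ≠ 0 := fun h0 => spectrum.zero_notMem ℂ u⁻¹.isUnit (h0 ▸ hz)
      have hz' : z⁻¹ ∈ spectrum ℂ (u : E →L[ℂ] E) := by
        simpa using (spectrum.inv_mem_iff (r := Units.mk0 z hz0) (a := u⁻¹)).1 hz
      -- `z⁻¹ + x` is a spectral value of `T`, hence real and at distance at least `ε` from `x`.
      rw [hu, ← spectrum.sub_singleton_eq] at hz'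
      obtain ⟨y, hy, _, rfl, hyz⟩ := hz'
      have hre := hT.mem_spectrum_eq_re hy
      rw [hre] at hy hyz
      have hle := h y.re hy
      have hn : ‖z‖⁻¹ = |y.re - x| := by
        rw [← norm_inv, ← hyz, ← Real.norm_eq_abs, ← Complex.norm_real, Complex.ofReal_sub]
      rw [← hn] at hle
      rw [ENNReal.coe_le_coe, ← NNReal.coe_le_coe,
        Real.coe_toNNReal _ (inv_nonneg.2 hε.le), coe_nnnorm]
      exact le_inv_of_le_inv₀ hε hle
    rw [hr] at hle
    have := NNReal.coe_le_coe.2 (ENNReal.coe_le_coe.1 hle)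
    rwa [Real.coe_toNNReal _ (inv_nonneg.2 hε.le), coe_nnnorm] at this
  have hφ : φ = (↑u⁻¹ : E →L[ℂ] E) (T φ - (x : ℂ) • φ) := by
    have h1 : (↑u⁻¹ * ↑u : E →L[ℂ] E) φ = φ := by simp
    have h2 : (u : E →L[ℂ] E) φ = T φ - (x : ℂ) • φ := by
      rw [hu]; simp [Algebra.algebraMap_eq_smul_one]
    rw [← h2]; exact h1.symm
  have := (↑u⁻¹ : E →L[ℂ] E).le_of_opNorm_le hnorm (T φ - (x : ℂ) • φ)
  rw [← hφ, inv_mul_eq_div, le_div_iff₀ hε, mul_comm] at this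
  exact this

end Hilbert

/-! ### Windows in `ℓ²(ℤ)` -/

namespace EllTwo

theorem hasSum_norm_sq (ψ : EllTwo) : HasSum (fun n => ‖ψ n‖ ^ 2) (‖ψ‖ ^ 2) := by
  simpa using lp.hasSum_norm (p := 2) (by norm_num) ψ

theorem norm_le_mul_norm {φ ψ : EllTwo} {c : ℝ} (hc : 0 ≤ c) (h : ∀ n, ‖φ n‖ ≤ c * ‖ψ n‖) :
    ‖φ‖ ≤ c * ‖ψ‖ := by
  have h₁ := hasSum_le (fun n => pow_le_pow_left₀ (norm_nonneg _) (h n) 2) (hasSum_norm_sq φ)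
    (by simpa only [mul_pow] using (hasSum_norm_sq ψ).mul_left (c ^ 2))
  rw [← mul_pow] at h₁
  exact le_of_sq_le_sq h₁ (by positivity)

theorem norm_translationOp_apply (m : ℤ) (ψ : EllTwo) : ‖translationOp m ψ‖ = ‖ψ‖ := by
  have h : HasSum (fun n => ‖translationOp m ψ n‖ ^ 2) (‖ψ‖ ^ 2) :=
    (Equiv.subRight m).hasSum_iff.2 (hasSum_norm_sq ψ)
  exact (sq_eq_sq₀ (norm_nonneg _) (norm_nonneg _)).1 ((hasSum_norm_sq _).unique h)

theorem norm_multiplicationOp_apply_le {A : Type*} [Finite A] [TopologicalSpace A]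
    (g : C(Config A, ℂ)) (ξ : Config A) (ψ : EllTwo) : ‖multiplicationOp g ξ ψ‖ ≤ ‖g‖ * ‖ψ‖ := by
  refine norm_le_mul_norm (norm_nonneg _) fun n => ?_
  rw [multiplicationOp_apply, norm_mul]
  exact mul_le_mul_of_nonneg_right (g.norm_coe_le_norm _) (norm_nonneg _)

/-- The restriction `ψ ↦ 1_{[j, j + N)} ψ`, as an operator on `ℓ²(ℤ)`. -/
noncomputable def window (N : ℕ) (j : ℤ) : EllTwo →L[ℂ] EllTwo :=
  lp.mapCLM 2 (fun n : ℤ => (if n - j ∈ Finset.Ico (0 : ℤ) N then (1 : ℂ) else 0) •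
    ContinuousLinearMap.id ℂ ℂ) zero_le_one (fun n => by
      rw [norm_smul, ContinuousLinearMap.norm_id, mul_one]
      split_ifs <;> simp)

theorem window_apply (N : ℕ) (j : ℤ) (ψ : EllTwo) (n : ℤ) :
    window N j ψ n = if n - j ∈ Finset.Ico (0 : ℤ) N then ψ n else 0 := by
  have h : window N j ψ n = (if n - j ∈ Finset.Ico (0 : ℤ) N then (1 : ℂ) else 0) * ψ n := rfl
  rw [h, ite_mul, one_mul, zero_mul]

/-- Cutting `ψ` off to all the translates of a finite set `F` counts each of its values `|F|`
times. -/
theorem hasSum_norm_sq_of_translates (F : Finset ℤ) {φ : ℤ → EllTwo} {ψ : EllTwo}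
    (h : ∀ j n, ‖φ j n‖ = if n - j ∈ F then ‖ψ n‖ else 0) :
    HasSum (fun j => ‖φ j‖ ^ 2) (F.card * ‖ψ‖ ^ 2) := by
  have h₁ : ∀ j, ‖φ j‖ ^ 2 = ∑ i ∈ F, ‖ψ (j + i)‖ ^ 2 := fun j => by
    have h₂ : HasSum (fun i => ‖φ j (j + i)‖ ^ 2) (‖φ j‖ ^ 2) :=
      (Equiv.addLeft j).hasSum_iff.2 (hasSum_norm_sq (φ j))
    refine h₂.unique ?_
    have h₃ : HasSum (fun i => ‖φ j (j + i)‖ ^ 2) (∑ i ∈ F, ‖φ j (j + i)‖ ^ 2) :=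
      hasSum_sum_of_ne_finset_zero fun i hi => by simp [h, hi]
    rwa [Finset.sum_congr rfl fun i hi => by rw [h j (j + i), if_pos (by simpa using hi)]] at h₃
  simp only [h₁]
  have h₂ : HasSum (fun j => ∑ i ∈ F, ‖ψ (j + i)‖ ^ 2) (∑ _i ∈ F, ‖ψ‖ ^ 2) :=
    hasSum_sum fun i _ =>
      (Equiv.addRight i).hasSum_iff (f := fun n => ‖ψ n‖ ^ 2) |>.2 (hasSum_norm_sq ψ)
  simpa using h₂

theorem hasSum_norm_sq_window (N : ℕ) (ψ : EllTwo) :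
    HasSum (fun j => ‖window N j ψ‖ ^ 2) (N * ‖ψ‖ ^ 2) := by
  simpa using hasSum_norm_sq_of_translates (Finset.Ico (0 : ℤ) N)
    (φ := fun j => window N j ψ) (ψ := ψ) fun j n => by
      rw [window_apply]
      split_ifs <;> simp

open scoped symmDiff in
/-- The intervals `[0, N)` form a Følner sequence. -/
theorem card_symmDiff_Ico_le (N : ℕ) (k : ℤ) :
    (Finset.Ico k (k + N) ∆ Finset.Ico (0 : ℤ) N).card ≤ 2 * k.natAbs := by
  have hsub : Finset.Ico k (k + N) ∆ Finset.Ico (0 : ℤ) N ⊆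
      Finset.Ico (min 0 k) (max 0 k) ∪ Finset.Ico (min N (k + N)) (max N (k + N)) := by
    intro i hi
    simp only [Finset.mem_symmDiff, Finset.mem_union, Finset.mem_Ico] at hi ⊢
    omega
  refine (Finset.card_le_card hsub).trans ((Finset.card_union_le _ _).trans ?_)
  simp only [Int.card_Ico]
  omega

open scoped symmDiff in
/-- The commutators of a translation with all the windows of length `N` are square summable, with a
bound that does not depend on `N`. -/
theorem exists_hasSum_norm_sq_commutator_window (N : ℕ) (k : ℤ) (ψ : EllTwo) :
    ∃ S ≤ 2 * (k.natAbs : ℝ) * ‖ψ‖ ^ 2, HasSum (fun j =>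
      ‖translationOp k (window N j ψ) - window N j (translationOp k ψ)‖ ^ 2) S := by
  refine ⟨_, ?_, hasSum_norm_sq_of_translates (Finset.Ico k (k + N) ∆ Finset.Ico (0 : ℤ) N)
    (ψ := translationOp k ψ) fun j n => ?_⟩
  · rw [norm_translationOp_apply]
    refine mul_le_mul_of_nonneg_right ?_ (by positivity)
    exact_mod_cast card_symmDiff_Ico_le N k
  · rw [lp.coeFn_sub, Pi.sub_apply, translationOp_apply, window_apply, window_apply,
      translationOp_apply]
    simp only [Finset.mem_symmDiff, Finset.mem_Ico]
    split_ifs <;> first | omega | simp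

end EllTwo

/-! ### Localization of lower bounds -/

namespace FiniteRangeHamiltonian

open EllTwo

section

variable {A : Type*} [Finite A] [TopologicalSpace A] (H : FiniteRangeHamiltonian A)

theorem op_window_sub (ξ : Config A) (N : ℕ) (j : ℤ) (ψ : EllTwo) :
    H.op ξ (window N j ψ) - window N j (H.op ξ ψ) = ∑ k ∈ H.K, multiplicationOp (H.t k) ξ
      (translationOp k (window N j ψ) - window N j (translationOp k ψ)) := by
  ext n
  rw [lp.coeFn_sub, Pi.sub_apply, op_apply, lp.coeFn_sum, Finset.sum_apply]
  simp only [multiplicationOp_apply, lp.coeFn_sub, Pi.sub_apply, window_apply,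
    translationOp_apply, op_apply]
  split_ifs
  · simp only [mul_sub, Finset.sum_sub_distrib]
    ring
  · simp

theorem norm_sq_op_window_sub_le (ξ : Config A) (N : ℕ) (j : ℤ) (ψ : EllTwo) :
    ‖H.op ξ (window N j ψ) - window N j (H.op ξ ψ)‖ ^ 2 ≤ H.K.card * ∑ k ∈ H.K, ‖H.t k‖ ^ 2 *
      ‖translationOp k (window N j ψ) - window N j (translationOp k ψ)‖ ^ 2 := by
  rw [op_window_sub]
  refine (pow_le_pow_left₀ (norm_nonneg _) ((norm_sum_le _ _).trans (Finset.sum_le_sum fun k _ =>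
    norm_multiplicationOp_apply_le _ _ _)) 2).trans ?_
  simpa only [mul_pow] using sq_sum_le_card_mul_sum_sq (s := H.K)
    (f := fun k => ‖H.t k‖ * ‖translationOp k (window N j ψ) - window N j (translationOp k ψ)‖)

/-- If `H_ξ - x` is bounded below on vectors supported in windows of a sufficiently large length
`N`, then it is bounded below. The length depends neither on `ξ` nor on `x`. -/
theorem exists_window_forall_mul_norm_le {δ : ℝ} (hδ : 0 < δ) : ∃ N : ℕ, ∀ (ξ : Config A) (x : ℝ),
    (∀ (j : ℤ) (φ : EllTwo), (∀ n, n ∉ Set.Ico j (j + N) → φ n = 0) →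
      δ * ‖φ‖ ≤ ‖H.op ξ φ - (x : ℂ) • φ‖) →
    ∀ ψ : EllTwo, δ / 2 * ‖ψ‖ ≤ ‖H.op ξ ψ - (x : ℂ) • ψ‖ := by
  set b : ℝ := H.K.card * ∑ k ∈ H.K, ‖H.t k‖ ^ 2 * (2 * (k.natAbs : ℝ)) with hb
  -- The commutators contribute at most `2 b ‖ψ‖²` to the sum over all windows, which has to stay
  -- below half of the `N δ² ‖ψ‖²` coming from the lower bounds.
  obtain ⟨N, hN⟩ := exists_nat_gt (max 0 (4 * b / δ ^ 2))
  have hN0 : (0 : ℝ) < N := (le_max_left _ _).trans_lt hN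
  have hNb : 4 * b < N * δ ^ 2 := (div_lt_iff₀ (by positivity)).1 ((le_max_right _ _).trans_lt hN)
  refine ⟨N, fun ξ x h ψ => ?_⟩
  choose S hS hSsum using fun k => exists_hasSum_norm_sq_commutator_window N k ψ
  have hj : ∀ j, δ ^ 2 * ‖window N j ψ‖ ^ 2 ≤
      2 * ‖window N j (H.op ξ ψ - (x : ℂ) • ψ)‖ ^ 2 + 2 * (H.K.card * ∑ k ∈ H.K, ‖H.t k‖ ^ 2 *
        ‖translationOp k (window N j ψ) - window N j (translationOp k ψ)‖ ^ 2) := fun j => by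
    have h₁ := h j (window N j ψ) fun n hn => by
      rw [window_apply, if_neg]
      simp only [Set.mem_Ico, Finset.mem_Ico] at hn ⊢
      omega
    have h₂ : H.op ξ (window N j ψ) - (x : ℂ) • window N j ψ =
        window N j (H.op ξ ψ - (x : ℂ) • ψ) +
          (H.op ξ (window N j ψ) - window N j (H.op ξ ψ)) := by
      rw [map_sub, map_smul]
      abel
    rw [h₂] at h₁
    have h₃ := h₁.trans (norm_add_le _ _)
    have h₄ := pow_le_pow_left₀ (by positivity) h₃ 2
    have h₅ := H.norm_sq_op_window_sub_le ξ N j ψ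
    have h₆ := add_sq_le (a := ‖window N j (H.op ξ ψ - (x : ℂ) • ψ)‖)
      (b := ‖H.op ξ (window N j ψ) - window N j (H.op ξ ψ)‖)
    rw [mul_pow] at h₄
    linarith
  have hsum := hasSum_le hj ((hasSum_norm_sq_window N ψ).mul_left (δ ^ 2))
    (((hasSum_norm_sq_window N (H.op ξ ψ - (x : ℂ) • ψ)).mul_left 2).add
      (((hasSum_sum fun k (_ : k ∈ H.K) => (hSsum k).mul_left (‖H.t k‖ ^ 2)).mul_left
        (H.K.card : ℝ)).mul_left 2))
  have hle : (H.K.card : ℝ) * ∑ k ∈ H.K, ‖H.t k‖ ^ 2 * S k ≤ b * ‖ψ‖ ^ 2 := by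
    rw [hb, mul_assoc, Finset.sum_mul]
    refine mul_le_mul_of_nonneg_left (Finset.sum_le_sum fun k _ => ?_) (Nat.cast_nonneg _)
    rw [mul_assoc]
    exact mul_le_mul_of_nonneg_left (hS k) (by positivity)
  have hψ := mul_le_mul_of_nonneg_right hNb.le (sq_nonneg ‖ψ‖)
  refine le_of_sq_le_sq (le_of_mul_le_mul_left ?_ hN0) (norm_nonneg _)
  rw [mul_pow, div_pow]
  linarith

theorem op_translationOp (ξ : Config A) (d : ℤ) (φ : EllTwo) :
    H.op ξ (translationOp d φ) = translationOp d (H.op (ξ.shift (-d)) φ) := by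
  have hs : ∀ n : ℤ, (ξ.shift (-d)).shift (-(n - d)) = ξ.shift (-n) := fun n => by
    funext i
    exact congrArg ξ (by ring)
  ext n
  simp only [op_apply, translationOp_apply, hs, sub_right_comm]

end

/-! ### Comparison of the spectra of configurations with common subwords -/

section

variable {A : Type*} [Finite A] [TopologicalSpace A] [DiscreteTopology A]

/-- A continuous function on the compact configuration space is determined, up to a given error,
by finitely many letters. -/
theorem _root_.Config.exists_radius_forall_norm_sub_le (g : C(Config A, ℂ)) {δ : ℝ}
    (hδ : 0 < δ) : ∃ R : ℕ, ∀ ξ η : Config A, (∀ i : ℤ, |i| ≤ R → ξ i = η i) →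
      ‖g ξ - g η‖ ≤ δ := by
  have hloc : ∀ ζ : Config A, ∃ R : ℕ, ∀ ξ : Config A, (∀ i : ℤ, |i| ≤ R → ξ i = ζ i) →
      ‖g ξ - g ζ‖ ≤ δ / 2 := fun ζ => by
    have hU : {ξ : Config A | ‖g ξ - g ζ‖ < δ / 2} ∈ 𝓝 ζ :=
      (isOpen_lt (by fun_prop) continuous_const).mem_nhds (by simpa using hδ)
    rw [nhds_pi, Filter.mem_pi] at hU
    obtain ⟨I, hI, V, hV, hVU⟩ := hU
    obtain ⟨R, hR⟩ := (hI.image Int.natAbs).bddAbove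
    refine ⟨R, fun ξ h => (hVU fun i hi => ?_).le⟩
    have hiR : i.natAbs ≤ R := hR ⟨i, hi, rfl⟩
    rw [h i (by rw [Int.abs_eq_natAbs]; exact_mod_cast hiR)]
    exact mem_of_mem_nhds (hV i)
  choose R hR using hloc
  have hopen : ∀ ζ : Config A, {ξ : Config A | ∀ i : ℤ, |i| ≤ R ζ → ξ i = ζ i} ∈ 𝓝 ζ := fun ζ => by
    have hfin : {i : ℤ | |i| ≤ R ζ}.Finite :=
      (Set.finite_Icc (-(R ζ : ℤ)) (R ζ)).subset fun i hi => abs_le.1 hi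
    have h := set_pi_mem_nhds (s := fun i => {ζ i}) hfin fun i _ =>
      (isOpen_discrete {ζ i}).mem_nhds (Set.mem_singleton (ζ i))
    exact h
  obtain ⟨s, hs⟩ := isCompact_univ.elim_nhds_subcover (X := Config A) _ fun ζ _ => hopen ζ
  refine ⟨s.sup fun ζ => R ζ, fun ξ η h => ?_⟩
  obtain ⟨ζ, hζ, hξ⟩ := Set.mem_iUnion₂.1 (hs.2 (Set.mem_univ ξ))
  have hη : ∀ i : ℤ, |i| ≤ R ζ → η i = ζ i := fun i hi => by
    rw [← h i (hi.trans (Int.ofNat_le.2 (Finset.le_sup hζ)))]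
    exact hξ i hi
  calc ‖g ξ - g η‖ ≤ ‖g ξ - g ζ‖ + ‖g η - g ζ‖ := by
        rw [norm_sub_rev (g η)]
        exact norm_sub_le_norm_sub_add_norm_sub _ _ _
    _ ≤ δ / 2 + δ / 2 := add_le_add (hR ζ ξ hξ) (hR ζ η hη)
    _ = δ := add_halves δ

variable (H : FiniteRangeHamiltonian A)

theorem exists_radius_norm_multiplicationOp_sub_le (g : C(Config A, ℂ)) (k : ℤ) {δ : ℝ}
    (hδ : 0 < δ) : ∃ R : ℕ, ∀ (N : ℕ) (j : ℤ) (ξ η : Config A) (φ : EllTwo),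
      (∀ m, j - R ≤ m → m ≤ j + N + R → ξ m = η m) →
      (∀ n, n ∉ Set.Ico j (j + N) → φ n = 0) →
      ‖multiplicationOp g ξ (translationOp k φ) - multiplicationOp g η (translationOp k φ)‖ ≤
        δ * ‖φ‖ := by
  obtain ⟨R, hR⟩ := Config.exists_radius_forall_norm_sub_le g hδ
  refine ⟨R + k.natAbs, fun N j ξ η φ h hφ => ?_⟩
  rw [← norm_translationOp_apply k φ]
  refine norm_le_mul_norm hδ.le fun n => ?_
  rw [lp.coeFn_sub, Pi.sub_apply, multiplicationOp_apply, multiplicationOp_apply,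
    translationOp_apply, ← sub_mul, norm_mul]
  by_cases hn : n - k ∈ Set.Ico j (j + N)
  · refine mul_le_mul_of_nonneg_right (hR _ _ fun i hi => h _ ?_ ?_) (norm_nonneg _)
    all_goals
      simp only [Set.mem_Ico] at hn
      rw [abs_le] at hi
      rw [Nat.cast_add]
      omega
  · simp [hφ _ hn]

theorem exists_radius_norm_op_sub_le {δ : ℝ} (hδ : 0 < δ) :
    ∃ R : ℕ, ∀ (N : ℕ) (j : ℤ) (ξ η : Config A) (φ : EllTwo),
      (∀ m, j - R ≤ m → m ≤ j + N + R → ξ m = η m) →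
      (∀ n, n ∉ Set.Ico j (j + N) → φ n = 0) → ‖H.op ξ φ - H.op η φ‖ ≤ δ * ‖φ‖ := by
  have hδ' : 0 < δ / (H.K.card + 1) := by positivity
  choose R hR using fun k => exists_radius_norm_multiplicationOp_sub_le (H.t k) k hδ'
  obtain ⟨R₀, hR₀⟩ := exists_radius_norm_multiplicationOp_sub_le H.v 0 hδ'
  refine ⟨H.K.sup R + R₀, fun N j ξ η φ h hφ => ?_⟩
  have h0 : translationOp 0 φ = φ := by
    ext n
    rw [translationOp_apply, sub_zero]
  have hsub : H.op ξ φ - H.op η φ =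
      ∑ k ∈ H.K, (multiplicationOp (H.t k) ξ (translationOp k φ) -
        multiplicationOp (H.t k) η (translationOp k φ)) +
      (multiplicationOp H.v ξ (translationOp 0 φ) -
        multiplicationOp H.v η (translationOp 0 φ)) := by
    rw [h0, Finset.sum_sub_distrib]
    simp only [op, add_apply, sum_apply, ContinuousLinearMap.comp_apply]
    abel
  rw [hsub]
  have hsum : ‖∑ k ∈ H.K, (multiplicationOp (H.t k) ξ (translationOp k φ) -
      multiplicationOp (H.t k) η (translationOp k φ))‖ ≤
      ∑ _k ∈ H.K, δ / (H.K.card + 1) * ‖φ‖ := by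
    refine norm_sum_le_of_le _ fun k hk => hR k N j ξ η φ (fun m h₁ h₂ => h m ?_ ?_) hφ
    all_goals
      have := Finset.le_sup (f := R) hk
      push_cast
      omega
  refine (norm_add_le_of_le hsum (hR₀ N j ξ η φ (fun m h₁ h₂ => h m ?_ ?_) hφ)).trans_eq ?_
  · push_cast; omega
  · push_cast; omega
  · rw [Finset.sum_const, nsmul_eq_mul]
    field_simp

/-- If all sufficiently long subwords of `η` occur in `ξ`, then the spectrum of `H_η` lies in a
small neighbourhood of the spectrum of `H_ξ`. -/
theorem exists_length_forall_mem_spec (hH : H.IsHermitian) {ε : ℝ} (hε : 0 < ε) :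
    ∃ l : ℕ, ∀ ξ η : Config A,
      (Set.range fun m => η.subword m l) ⊆ (Set.range fun m => ξ.subword m l) →
      ∀ x ∈ H.spec hH η, ∃ y ∈ H.spec hH ξ, dist x y ≤ ε := by
  obtain ⟨N, hN⟩ := H.exists_window_forall_mul_norm_le (half_pos hε)
  obtain ⟨R, hR⟩ := H.exists_radius_norm_op_sub_le (half_pos hε)
  refine ⟨N + 2 * R + 1, fun ξ η hsub x hx => ?_⟩
  by_contra! hfar
  have hlow := (H.isSelfAdjoint_op hH ξ).mul_norm_le_of_forall_le_abs_sub hε (x := x)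
    fun y hy => by
      rw [← Real.dist_eq, dist_comm]
      exact (hfar y hy).le
  have hη : ∀ ψ : EllTwo, ε / 2 / 2 * ‖ψ‖ ≤ ‖H.op η ψ - (x : ℂ) • ψ‖ := by
    refine hN η x fun j φ hφ => ?_
    obtain ⟨m', hm'⟩ := hsub ⟨j - R, rfl⟩
    set d : ℤ := m' - (j - R)
    -- The translate of `ξ` by `-d` agrees with `η` on all the letters relevant to `φ`.
    have hagree : ∀ m, j - R ≤ m → m ≤ j + N + R → (ξ.shift (-d)) m = η m := fun m h₁ h₂ => by
      have := Config.apply_eq_of_subword_eq hm' (i := (m - (j - R)).toNat) (by omega)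
      rw [Int.toNat_of_nonneg (by omega)] at this
      calc ξ (m - -d) = ξ (m' + (m - (j - R))) := congrArg ξ (by simp only [d]; ring)
        _ = η (j - R + (m - (j - R))) := this
        _ = η m := congrArg η (by ring)
    have h₁ := hR N j _ η φ hagree hφ
    have h₂ := hlow (translationOp d φ)
    rw [op_translationOp, ← map_smul, ← map_sub, norm_translationOp_apply,
      norm_translationOp_apply] at h₂
    have h₃ : H.op (ξ.shift (-d)) φ - (x : ℂ) • φ =
        (H.op (ξ.shift (-d)) φ - H.op η φ) + (H.op η φ - (x : ℂ) • φ) := by abel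
    rw [h₃] at h₂
    have h₄ := h₂.trans (norm_add_le _ _)
    linarith
  have hunit : IsUnit (H.op η - algebraMap ℂ (EllTwo →L[ℂ] EllTwo) x) := by
    refine ((H.isSelfAdjoint_op hH η).sub (IsSelfAdjoint.algebraMap _
      (Complex.conj_ofReal x))).isUnit_of_forall_mul_norm_le (c := ε / 2 / 2) (by positivity) ?_
    intro ψ
    exact hη ψ
  rw [← neg_sub, IsUnit.neg_iff, ← spectrum.notMem_iff] at hunit
  exact hunit hx

end

end FiniteRangeHamiltonian

theorem mainTheorem8 (H : FiniteRangeHamiltonian GRSLetter) (hH : H.IsHermitian)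
    (ξ : Config GRSLetter) (hξ : ξ ∈ GRSLetter.subshift) (x : GRSLetter) :
    Tendsto (fun k : ℕ => H.spec hH (GRSLetter.eta x k)) atTop (𝓝 (H.spec hH ξ)) := by
  refine tendsto_iff_dist_tendsto_zero.2 (Metric.tendsto_nhds.2 fun ε hε => ?_)
  obtain ⟨l, hl⟩ := H.exists_length_forall_mem_spec hH (half_pos hε)
  filter_upwards [GRSLetter.eventually_range_subword_eta_eq hξ x l] with k hk
  rw [Real.dist_0_eq_abs, abs_of_nonneg dist_nonneg, Metric.NonemptyCompacts.dist_eq]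
  refine (Metric.hausdorffDist_le_of_mem_dist (half_pos hε).le ?_ ?_).trans_lt (half_lt_self hε)
  · exact hl ξ _ hk.subset
  · exact hl _ ξ hk.symm.subset
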